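/- Setting. Let $d\in\mathbb{N}$ and let $\{\psi_\lambda\}_{\lambda\in\Lambda}$ be a smooth (Meyer-type) orthonormal wavelet basis of the real space $L_2(\mathbb{R}^d)$, consisting of the integer translates of a scaling function ($|\lambda|=0$) and of the functions $2^{jd/2}\psi^e(2^j\cdot-k)$, $1\le e\le 2^d-1$, $j\ge 0$, $k\in\mathbb{Z}^d$ ($|\lambda|=j$), where the scaling function and the mother wavelets $\psi^e$ are Schwartz functions and all moments of the $\psi^e$ vanish. For $s\in\mathbb{R}$, $0<p<\infty$ let $B^s_p=B^s_{p,p}(\mathbb{R}^d)$ be the space of real tempered distributions $u=\sum_\lambda u_\lambda\psi_\lambda$ (unconditional convergence in $\mathcal{S}'$), $u_\lambda=\langle u,\psi_\lambda\rangle$, with $$\|u\|_{B^s_p}=\Big(\sum_{\lambda\in\Lambda}2^{p(s+d(\frac12-\frac1p))|\lambda|}\,|u_\lambda|^p\Big)^{1/p}<\infty ,$$ put $\|u\|_{B^s_p}=\infty$ for $u\notin B^s_p$, and let $H^s=B^s_2$. Let $\mathcal{B}_X=B^{s_X}_{p_X}$ for $X\in\{D,S,G,R\}$. Theorem. Let $s_D,s_S,s_G\in\mathbb{R}$,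 $p_D>1$ and $0<p_S\le p_G<\infty$. Let $F:\mathcal{B}_D\to L_2(\mathbb{R}^d)$ be linear and continuous and suppose that its adjoint satisfies $\mathcal{B}_G\subset\operatorname{rg}F^*$ (for instance $\operatorname{rg}F^*=\mathcal{B}_G$), where elements of $\mathcal{B}_D^*$ are identified with the tempered distributions they induce on Schwartz functions. Let $\mathcal{B}_S\subset\mathcal{B}_D$, $u^\dagger\in\mathcal{B}_S$ and $v=Fu^\dagger$. Let $$p_R=\frac{p_S+p_G}{p_G},\qquad s_R\le\frac{p_Ss_S-p_Gs_G}{p_S+p_G},\qquad \sigma=s_R+d\Big(\frac12-\frac1{p_R}\Big).$$ Then for all constants $c,C>0$ there are $K>0$ and $\delta_0>0$ such that for all $0<\delta\le\delta_0$, all $\alpha$ with $c\,\delta\le\alpha\le C\,\delta$, all $v^\delta\in L_2(\mathbb{R}^d)$ with $\|v-v^\delta\|_{L_2}\le\delta$ and every minimizer $u^{\alpha,\delta}$ over $\mathcal{B}_D$ of $$T_\alpha(u)=\|Fu-v^\delta\|_{L_2}^2+\alpha\,\|u\|_{\mathcal{B}_R}^{p_R}\in[0,\infty],$$ we have $u^{\alpha,\delta}-u^\dagger\in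 H^\sigma$ and $\|u^{\alpha,\delta}-u^\dagger\|_{H^\sigma}\le K\sqrt\delta$. -/

import Mathlib

open MeasureTheory Filter Topology
open scoped ENNReal SchwartzMap

noncomputable section

namespace BesovTikhonov

/-- Euclidean space `ℝ^d`. -/
abbrev Space (d : ℕ) : Type := EuclideanSpace ℝ (Fin d)

/-- The space `𝓢'(ℝ^d)` of real-valued tempered distributions. -/
abbrev Distr (d : ℕ) : Type := 𝓢(Space d, ℝ) →L[ℝ] ℝ

/-- The real Lebesgue space `L₂(ℝ^d)`. -/
abbrev LTwo (d : ℕ) : Type := Lp ℝ 2 (volume : Measure (Space d))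

/-- The lattice point `k ∈ ℤ^d` as a vector of `ℝ^d`. -/
def latticePoint {d : ℕ} (k : Fin d → ℤ) : Space d :=
  WithLp.toLp 2 (fun i => (k i : ℝ))

/-- The dilation `x ↦ 2^j x` of `ℝ^d`. -/
def dilation (d j : ℕ) : Space d ≃L[ℝ] Space d :=
  ContinuousLinearEquiv.smulLeft (Units.mk0 ((2 : ℝ) ^ j) (by positivity))

/-- The function `x ↦ 2^(j d / 2) f (2^j x - k)`, as a Schwartz function. -/
def dilateTranslate {d : ℕ} (f : 𝓢(Space d, ℝ)) (j : ℕ) (k : Fin d → ℤ) : 𝓢(Space d, ℝ) :=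
  ((2 : ℝ) ^ ((j : ℝ) * (d : ℝ) / 2)) •
    SchwartzMap.compCLMOfContinuousLinearEquiv ℝ (dilation d j)
      (SchwartzMap.compSubConstCLM ℝ (latticePoint k) f)

theorem dilateTranslate_apply {d : ℕ} (f : 𝓢(Space d, ℝ)) (j : ℕ) (k : Fin d → ℤ) (x : Space d) :
    dilateTranslate f j k x =
      (2 : ℝ) ^ ((j : ℝ) * (d : ℝ) / 2) * f ((2 : ℝ) ^ j • x - latticePoint k) := by
  rfl

/-- The index set `Λ` of an inhomogeneous wavelet basis of `L₂(ℝ^d)`: translates `k ∈ ℤ^d` of the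
scaling function, and triples `(e, j, k)` for the `2^d - 1` mother wavelets, the scales `j ≥ 0` and
the translations `k ∈ ℤ^d`. -/
inductive Index (d : ℕ) : Type
  | scaling (k : Fin d → ℤ) : Index d
  | wavelet (e : Fin (2 ^ d - 1)) (j : ℕ) (k : Fin d → ℤ) : Index d

/-- The scale `|λ|` of an index `λ ∈ Λ`. -/
def Index.scale {d : ℕ} : Index d → ℕ
  | .scaling _ => 0
  | .wavelet _ j _ => j

/-- The functions generated by a scaling function and mother wavelets. -/
def waveletFamily {d : ℕ} (father : 𝓢(Space d, ℝ)) (mother : Fin (2 ^ d - 1) → 𝓢(Space d, ℝ)) :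
    Index d → 𝓢(Space d, ℝ)
  | .scaling k => dilateTranslate father 0 k
  | .wavelet e j k => dilateTranslate (mother e) j k

/-- A smooth orthonormal wavelet basis of `L₂(ℝ^d)` (of Meyer type): the scaling function and the
mother wavelets are real Schwartz functions, all moments of the mother wavelets vanish, and the
generated family is an orthonormal basis of `L₂(ℝ^d)`. -/
structure WaveletBasis (d : ℕ) where
  father : 𝓢(Space d, ℝ)
  mother : Fin (2 ^ d - 1) → 𝓢(Space d, ℝ)
  moment_eq_zero : ∀ (e : Fin (2 ^ d - 1)) (n : Fin d → ℕ),
    ∫ x : Space d, (∏ i, x i ^ n i) * mother e x = 0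
  orthonormal : Orthonormal ℝ
    (fun i : Index d => ((waveletFamily father mother i).toLp 2 volume : LTwo d))
  complete : (Submodule.span ℝ (Set.range
    (fun i : Index d => ((waveletFamily father mother i).toLp 2 volume : LTwo d)))).topologicalClosure
      = ⊤

/-- The wavelet `ψ_λ`. -/
def WaveletBasis.psi {d : ℕ} (W : WaveletBasis d) (i : Index d) : 𝓢(Space d, ℝ) :=
  waveletFamily W.father W.mother i

/-- The factor `2^((s + d (1/2 - 1/p)) |λ|)`. -/
def weight {d : ℕ} (s p : ℝ) (i : Index d) : ℝ :=
  (2 : ℝ) ^ ((s + (d : ℝ) * (1 / 2 - 1 / p)) * (i.scale : ℝ))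

/-- The Besov space `B^s_{p,p}(ℝ^d)` for `s ∈ ℝ`, `0 < p < ∞`: the tempered distributions `u` whose
wavelet coefficients `u_λ = ⟨u, ψ_λ⟩` satisfy
`∑_λ 2^(p (s + d (1/2 - 1/p)) |λ|) |u_λ|^p < ∞` and which are the sum of their wavelet series
`∑_λ u_λ ψ_λ`, with unconditional convergence in `𝓢'`. -/
def Besov {d : ℕ} (W : WaveletBasis d) (s p : ℝ) : Submodule ℝ (Distr d) where
  carrier := {u |
    Memℓp (fun i : Index d => weight s p i * u (W.psi i)) (ENNReal.ofReal p) ∧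
    ∀ φ : 𝓢(Space d, ℝ),
      HasSum (fun i : Index d => u (W.psi i) * ∫ x, W.psi i x * φ x) (u φ)}
  zero_mem' := by
    refine ⟨?_, fun φ => ?_⟩
    · have h := zero_memℓp (E := fun _ : Index d => ℝ) (p := ENNReal.ofReal p)
      convert h using 1
      funext i
      exact mul_zero _
    · have h : HasSum (fun _ : Index d => (0 : ℝ)) 0 := hasSum_zero
      convert h using 1
      · funext i
        exact zero_mul _
      · rfl
  add_mem' := by
    rintro u v ⟨hu, hu'⟩ ⟨hv, hv'⟩
    refine ⟨?_, fun φ => ?_⟩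
    · have h := hu.add hv
      convert h using 1
      funext i
      simp [mul_add]
    · have h := (hu' φ).add (hv' φ)
      simpa [add_mul] using h
  smul_mem' := by
    rintro c u ⟨hu, hu'⟩
    refine ⟨?_, fun φ => ?_⟩
    · have h := hu.const_mul c
      have e : (fun i : Index d => weight s p i * (c • u) (W.psi i)) =
          fun i => c * (weight s p i * u (W.psi i)) := by
        funext i
        exact mul_left_comm (weight s p i) c (u (W.psi i))
      exact e ▸ h
    · have h := (hu' φ).mul_left c
      simpa [mul_assoc] using h

/-- The Besov norm
`‖u‖ = (∑_λ 2^(p (s + d (1/2 - 1/p)) |λ|) |u_λ|^p)^(1/p)`, to be used for `u ∈ B^s_{p,p}`. -/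
def besovNorm {d : ℕ} (W : WaveletBasis d) (s p : ℝ) (u : Distr d) : ℝ :=
  (∑' i : Index d,
    (2 : ℝ) ^ (p * (s + (d : ℝ) * (1 / 2 - 1 / p)) * (i.scale : ℝ)) * |u (W.psi i)| ^ p) ^ (1 / p)

open Classical in
/-- The Besov norm extended to all tempered distributions by `∞` outside of `B^s_{p,p}`. -/
def besovENorm {d : ℕ} (W : WaveletBasis d) (s p : ℝ) (u : Distr d) : ℝ≥0∞ :=
  if u ∈ Besov W s p then ENNReal.ofReal (besovNorm W s p u) else ⊤

/-- Continuity of a linear operator `F : B^s_{p,p} → L₂`. -/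
def IsBoundedOp {d : ℕ} (W : WaveletBasis d) {s p : ℝ} (F : Besov W s p →ₗ[ℝ] LTwo d) : Prop :=
  ∃ M : ℝ, ∀ u : Besov W s p, ‖F u‖ ≤ M * besovNorm W s p (u : Distr d)

/-- The range of the adjoint `F^* : L₂ → (B^s_{p,p})^*` of `F : B^s_{p,p} → L₂`. As usual, a
functional on `B^s_{p,p}` is identified with the tempered distribution that it induces on the
Schwartz functions (which form a dense subspace of `B^s_{p,p}`), so `F^* w` is the tempered
distribution `φ ↦ ⟨w, F φ⟩`. -/
def adjointRange {d : ℕ} (W : WaveletBasis d) {s p : ℝ} (F : Besov W s p →ₗ[ℝ] LTwo d) :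
    Set (Distr d) :=
  {g | ∃ w : LTwo d, ∀ (φ : 𝓢(Space d, ℝ)) (u : Besov W s p),
    (∀ χ : 𝓢(Space d, ℝ), (u : Distr d) χ = ∫ x, φ x * χ x) → g φ = inner ℝ w (F u)}

/-- The Tikhonov functional `T_α(u) = ‖F u - v^δ‖² + α ‖u‖_{B_R}^{p_R}` on `B_D`, with values in
`[0, ∞]`, where `B_R = B^{s_R}_{p_R,p_R}`. -/
def tikhonov {d : ℕ} (W : WaveletBasis d) {sD pD : ℝ} (F : Besov W sD pD →ₗ[ℝ] LTwo d)
    (sR pR α : ℝ) (vδ : LTwo d) (u : Besov W sD pD) : ℝ≥0∞ :=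
  ENNReal.ofReal (‖F u - vδ‖ ^ 2) + ENNReal.ofReal α * besovENorm W sR pR (u : Distr d) ^ pR

end BesovTikhonov

end

/-!
For `1 < p_R ≤ 2` the penalty `‖·‖_{B_R}^{p_R}` is the `p_R`-th power of an `ℓ^{p_R}` norm of
weighted wavelet coefficients, and its gradient at `u†` has the weighted coefficients
`2^((s_R + d (1/2 - 1/p_R)) |λ|) p_R |·|^(p_R - 1)`, up to sign. The choice of `p_R` and `s_R` is
exactly what puts this gradient into `B_G` whenever `u† ∈ B_S`: since `(p_R - 1) p_G = p_S`, its
`p_G`-th powers are dominated by the `p_S`-th powers of the coefficients of `u†`. As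
`B_G ⊂ rg F^*`, the gradient equals `F^* w` for some `w ∈ L₂`, which is a source condition.

Minimality then bounds the Bregman distance of the penalty between `u^{α,δ}` and `u†` by a multiple
of `δ`: the linear term is `⟨w, F u^{α,δ} - v⟩` and is absorbed into the data misfit by completing
the square. Since `x ↦ |x|^p` is strongly convex on bounded intervals for `1 < p ≤ 2`, and the
coefficients of all minimizers are uniformly bounded, the Bregman distance dominates a multiple of
the squared `ℓ²` norm of the difference of the coefficients, which is `‖u^{α,δ} - u†‖_{H^σ}²`.

The vanishing moments enter only through the fact that every element of `B_G` prescribed by its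
coefficients exists as a distribution: by Taylor expansion the wavelet coefficients of a Schwartz
function decay faster than any power of `2^|λ|`, so wavelet series with coefficients of exponential
growth in `|λ|` converge in `𝓢'`.
-/

namespace BesovTikhonov

theorem one_add_norm_le_mul {E : Type*} [SeminormedAddCommGroup E] (x w : E) :
    1 + ‖x‖ ≤ (1 + ‖x + w‖) * (1 + ‖w‖) := by
  have := norm_le_add_norm_add x w
  nlinarith [mul_nonneg (norm_nonneg (x + w)) (norm_nonneg w)]

section Taylor

variable {E F : Type*} [NormedAddCommGroup E] [NormedSpace ℝ E]
  [NormedAddCommGroup F] [NormedSpace ℝ F]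

theorem norm_sub_taylor_le [CompleteSpace F] {f : E → F} {N : ℕ} (hf : ContDiff ℝ N f) {x z : E}
    {B : ℝ} (hB : ∀ t ∈ Set.Icc (0 : ℝ) 1, ‖iteratedFDeriv ℝ N f (x + t • z)‖ ≤ B) :
    ‖f (x + z) - ∑ n ∈ Finset.range N, (n.factorial : ℝ)⁻¹ • iteratedFDeriv ℝ n f x fun _ => z‖ ≤
      B * ‖z‖ ^ N := by
  have hderiv (t : ℝ) (ht : t ∈ Set.Icc (0 : ℝ) 1) :
      ‖iteratedFDeriv ℝ N f (x + t • z) fun _ => z‖ ≤ B * ‖z‖ ^ N := by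
    refine (ContinuousMultilinearMap.le_opNorm _ _).trans ?_
    simpa using mul_le_mul_of_nonneg_right (hB t ht) (pow_nonneg (norm_nonneg z) N)
  cases N with
  | zero => simpa using hderiv 1 (by simp)
  | succ n =>
    rw [map_add_eq_sum_add_integral_iteratedFDeriv fun _ _ => hf.contDiffAt, add_sub_cancel_left,
      norm_smul]
    have hintegral : ‖∫ t in (0 : ℝ)..1, (1 - t) ^ n •
        iteratedFDeriv ℝ (n + 1) f (x + t • z) fun _ => z‖ ≤ B * ‖z‖ ^ (n + 1) := by
      refine (intervalIntegral.norm_integral_le_of_norm_le_const fun t ht => ?_).trans_eq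
        (by rw [sub_zero, abs_one, mul_one])
      rw [Set.uIoc_of_le zero_le_one] at ht
      rw [norm_smul, norm_pow, Real.norm_of_nonneg (sub_nonneg.2 ht.2)]
      exact (mul_le_of_le_one_left (norm_nonneg _)
        (pow_le_one₀ (sub_nonneg.2 ht.2) (by linarith [ht.1]))).trans
        (hderiv t (Set.Ioc_subset_Icc_self ht))
    have hfactorial : ‖(n.factorial : ℝ)⁻¹‖ ≤ 1 := by
      rw [norm_inv, Real.norm_natCast]
      exact inv_le_one_of_one_le₀ (mod_cast n.factorial_pos)
    exact (mul_le_of_le_one_left (norm_nonneg _) hfactorial).trans hintegral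

/-- The largest of the Schwartz seminorms with indices `(k, l) ≤ m`. -/
noncomputable abbrev maxSeminorm (m : ℕ × ℕ) : Seminorm ℝ 𝓢(E, F) :=
  (Finset.Iic m).sup (schwartzSeminormFamily ℝ E F)

theorem one_add_norm_pow_mul_norm_sub_taylor_le [CompleteSpace F] (φ : 𝓢(E, F)) (M N : ℕ)
    (x z : E) :
    (1 + ‖x‖) ^ M * ‖φ (x + z) -
        ∑ n ∈ Finset.range N, (n.factorial : ℝ)⁻¹ • iteratedFDeriv ℝ n φ x fun _ => z‖ ≤
      2 ^ M * maxSeminorm (M, N) φ * ((1 + ‖z‖) ^ M * ‖z‖ ^ N) := by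
  have hpos : 0 < (1 + ‖x‖) ^ M := by positivity
  have hderiv (t : ℝ) (ht : t ∈ Set.Icc (0 : ℝ) 1) : ‖iteratedFDeriv ℝ N φ (x + t • z)‖ ≤
      2 ^ M * maxSeminorm (M, N) φ * (1 + ‖z‖) ^ M / (1 + ‖x‖) ^ M := by
    have htz : ‖t • z‖ ≤ ‖z‖ := by
      rw [norm_smul, Real.norm_of_nonneg ht.1]
      exact mul_le_of_le_one_left (norm_nonneg z) ht.2
    rw [le_div_iff₀ hpos]
    calc ‖iteratedFDeriv ℝ N φ (x + t • z)‖ * (1 + ‖x‖) ^ M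
        ≤ ‖iteratedFDeriv ℝ N φ (x + t • z)‖ * ((1 + ‖x + t • z‖) * (1 + ‖z‖)) ^ M := by
          gcongr
          exact (one_add_norm_le_mul x (t • z)).trans (by gcongr)
      _ = (1 + ‖x + t • z‖) ^ M * ‖iteratedFDeriv ℝ N φ (x + t • z)‖ * (1 + ‖z‖) ^ M := by
          rw [mul_pow]; ring
      _ ≤ _ := by
          refine mul_le_mul_of_nonneg_right ?_ (by positivity)
          exact SchwartzMap.one_add_le_sup_seminorm_apply (𝕜 := ℝ) (m := (M, N)) le_rfl le_rfl φ _
  refine (mul_le_mul_of_nonneg_left (norm_sub_taylor_le (φ.smooth N) hderiv) hpos.le).trans_eq ?_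
  field_simp

theorem one_add_norm_pow_mul_norm_sub_taylor_smul_le [CompleteSpace F] (φ : 𝓢(E, F)) (M N : ℕ)
    (x z : E) {c : ℝ} (hc0 : 0 ≤ c) (hc1 : c ≤ 1) :
    (1 + ‖x‖) ^ M * ‖φ (x + c • z) - ∑ n ∈ Finset.range N,
        ((n.factorial : ℝ)⁻¹ * c ^ n) • iteratedFDeriv ℝ n φ x fun _ => z‖ ≤
      2 ^ M * maxSeminorm (M, N) φ * c ^ N * (1 + ‖z‖) ^ (M + N) := by
  have htaylor : ∑ n ∈ Finset.range N,
        ((n.factorial : ℝ)⁻¹ * c ^ n) • (iteratedFDeriv ℝ n φ x fun _ => z) =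
      ∑ n ∈ Finset.range N, (n.factorial : ℝ)⁻¹ • iteratedFDeriv ℝ n φ x fun _ => c • z := by
    refine Finset.sum_congr rfl fun n _ => ?_
    rw [(iteratedFDeriv ℝ n φ x).map_smul_univ (fun _ => c) fun _ => z, Finset.prod_const,
      Finset.card_univ, Fintype.card_fin, smul_smul]
  have hcz : ‖c • z‖ = c * ‖z‖ := by rw [norm_smul, Real.norm_of_nonneg hc0]
  rw [htaylor]
  calc _ ≤ 2 ^ M * maxSeminorm (M, N) φ * ((1 + ‖c • z‖) ^ M * ‖c • z‖ ^ N) :=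
        one_add_norm_pow_mul_norm_sub_taylor_le φ M N x (c • z)
    _ ≤ 2 ^ M * maxSeminorm (M, N) φ * ((1 + ‖z‖) ^ M * (c * (1 + ‖z‖)) ^ N) := by
        rw [hcz]
        gcongr
        · exact mul_le_of_le_one_left (norm_nonneg z) hc1
        · linarith
    _ = _ := by rw [mul_pow, pow_add]; ring

end Taylor

section VanishingMoments

variable {E : Type*} [NormedAddCommGroup E] [NormedSpace ℝ E] [MeasurableSpace E]

/-- The moments of order less than `N` of `f` vanish. The moments of order `n` are taken against
all homogeneous polynomials of degree `n`, written as diagonals of continuous `n`-linear forms, so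
that no basis of `E` is involved. -/
def HasVanishingMoments (μ : Measure E) (f : E → ℝ) (N : ℕ) : Prop :=
  ∀ n < N, ∀ m : E [×n]→L[ℝ] ℝ, ∫ y, (m fun _ => y) * f y ∂μ = 0

variable [BorelSpace E] [SecondCountableTopology E] {μ : Measure E} [μ.HasTemperateGrowth]

theorem integrable_multilinear_mul (f : 𝓢(E, ℝ)) {n : ℕ} (m : E [×n]→L[ℝ] ℝ) :
    Integrable (fun y => (m fun _ => y) * f y) μ := by
  have hm : Continuous fun y : E => m fun _ => y := m.cont.comp (by fun_prop)
  refine ((f.integrable_pow_mul μ n).const_mul ‖m‖).mono'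
    (hm.mul f.continuous).aestronglyMeasurable (Eventually.of_forall fun y => ?_)
  rw [norm_mul, ← mul_assoc]
  gcongr
  simpa using m.le_opNorm fun _ => y

theorem integrable_one_add_norm_pow_mul_norm (f : 𝓢(E, ℝ)) (M : ℕ) :
    Integrable (fun y => (1 + ‖y‖) ^ M * ‖f y‖) μ := by
  simp only [add_comm (1 : ℝ), add_pow, one_pow, mul_one, Finset.sum_mul]
  refine integrable_finsetSum _ fun i _ => ?_
  simpa only [mul_right_comm] using (f.integrable_pow_mul μ i).mul_const (M.choose i : ℝ)

theorem integrable_sum_multilinear_mul (f : 𝓢(E, ℝ)) (m : ∀ n, E [×n]→L[ℝ] ℝ) (N : ℕ) :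
    Integrable (fun y => (∑ n ∈ Finset.range N, m n fun _ => y) * f y) μ := by
  simp only [Finset.sum_mul]
  exact integrable_finsetSum _ fun n _ => integrable_multilinear_mul f (m n)

theorem HasVanishingMoments.integral_sum_multilinear_mul {f : 𝓢(E, ℝ)} {N : ℕ}
    (hf : HasVanishingMoments μ f N) (m : ∀ n, E [×n]→L[ℝ] ℝ) :
    ∫ y, (∑ n ∈ Finset.range N, m n fun _ => y) * f y ∂μ = 0 := by
  simp only [Finset.sum_mul]
  rw [integral_finsetSum _ fun n _ => integrable_multilinear_mul f (m n)]
  exact Finset.sum_eq_zero fun n hn => hf n (Finset.mem_range.1 hn) (m n)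

/-- The Taylor polynomial of `φ` at `x` of degree less than `N` may be subtracted from `φ` without
changing the integral. -/
theorem HasVanishingMoments.exists_integral_comp_le {f : 𝓢(E, ℝ)} {N : ℕ}
    (hf : HasVanishingMoments μ f N) (M : ℕ) :
    ∃ C, 0 ≤ C ∧ ∀ (φ : 𝓢(E, ℝ)) (x : E) (c : ℝ), 0 ≤ c → c ≤ 1 →
      (1 + ‖x‖) ^ M * |∫ y, φ (x + c • y) * f y ∂μ| ≤ C * c ^ N * maxSeminorm (M, N) φ := by
  refine ⟨2 ^ M * ∫ y, (1 + ‖y‖) ^ (M + N) * ‖f y‖ ∂μ,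
    mul_nonneg (by positivity) (integral_nonneg fun y => by positivity), fun φ x c hc0 hc1 => ?_⟩
  let m (n : ℕ) : E [×n]→L[ℝ] ℝ := ((n.factorial : ℝ)⁻¹ * c ^ n) • iteratedFDeriv ℝ n φ x
  let T (y : E) : ℝ := ∑ n ∈ Finset.range N, m n fun _ => y
  have hremainder (y : E) : ‖(1 + ‖x‖) ^ M * (φ (x + c • y) * f y - T y * f y)‖ ≤
      2 ^ M * maxSeminorm (M, N) φ * c ^ N * ((1 + ‖y‖) ^ (M + N) * ‖f y‖) := by
    rw [← sub_mul, norm_mul, norm_mul, Real.norm_of_nonneg (by positivity), ← mul_assoc,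
      ← mul_assoc]
    exact mul_le_mul_of_nonneg_right
      (one_add_norm_pow_mul_norm_sub_taylor_smul_le φ M N x y hc0 hc1) (norm_nonneg _)
  have hφ : Integrable (fun y => φ (x + c • y) * f y) μ :=
    f.integrable.bdd_mul (c := SchwartzMap.seminorm ℝ 0 0 φ)
      (φ.continuous.comp (by fun_prop)).aestronglyMeasurable
      (Eventually.of_forall fun y => φ.norm_le_seminorm ℝ _)
  have hsubtract : ∫ y, φ (x + c • y) * f y ∂μ = ∫ y, (φ (x + c • y) * f y - T y * f y) ∂μ := by
    rw [integral_sub hφ (integrable_sum_multilinear_mul f m N),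
      hf.integral_sum_multilinear_mul, sub_zero]
  calc (1 + ‖x‖) ^ M * |∫ y, φ (x + c • y) * f y ∂μ|
      = ‖∫ y, (1 + ‖x‖) ^ M * (φ (x + c • y) * f y - T y * f y) ∂μ‖ := by
        rw [hsubtract, integral_const_mul, norm_mul, Real.norm_of_nonneg (by positivity),
          Real.norm_eq_abs]
    _ ≤ ∫ y, 2 ^ M * maxSeminorm (M, N) φ * c ^ N * ((1 + ‖y‖) ^ (M + N) * ‖f y‖) ∂μ :=
        norm_integral_le_of_norm_le ((integrable_one_add_norm_pow_mul_norm f _).const_mul _)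
          (Eventually.of_forall hremainder)
    _ = _ := by rw [integral_const_mul]; ring

end VanishingMoments

section Lattice

theorem summable_pi_prod {ι : Type*} {f : ι → ℝ} (hf0 : 0 ≤ f) (hf : Summable f) (d : ℕ) :
    Summable fun k : Fin d → ι => ∏ i, f (k i) := by
  induction d with
  | zero => exact Summable.of_finite
  | succ d ih =>
    rw [← (Fin.consEquiv fun _ : Fin (d + 1) => ι).summable_iff]
    refine (hf.mul_of_nonneg ih hf0 fun k => Finset.prod_nonneg fun i _ => hf0 (k i)).congr ?_
    simp [Fin.prod_univ_succ, Fin.consEquiv]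

theorem summable_one_add_abs_int_sq_inv : Summable fun n : ℤ => ((1 + |(n : ℝ)|) ^ 2)⁻¹ := by
  have hnat : Summable fun n : ℕ => ((1 + (n : ℝ)) ^ 2)⁻¹ := by
    simpa [add_comm] using (summable_nat_add_iff 1).2 (Real.summable_nat_pow_inv.2 one_lt_two)
  exact Summable.of_nat_of_neg (by simpa using hnat) (by simpa using hnat)

theorem summable_one_add_norm_latticePoint_inv (d : ℕ) :
    Summable fun k : Fin d → ℤ => ((1 + ‖latticePoint k‖) ^ (2 * d))⁻¹ := by
  refine .of_nonneg_of_le (fun k => by positivity) (fun k => ?_)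
    (summable_pi_prod (fun n => by positivity) summable_one_add_abs_int_sq_inv d)
  rw [Finset.prod_inv_distrib]
  refine inv_anti₀ (Finset.prod_pos fun i _ => by positivity) ?_
  calc ∏ i, (1 + |(k i : ℝ)|) ^ 2 ≤ ∏ _i : Fin d, (1 + ‖latticePoint k‖) ^ 2 := by
        gcongr with i
        exact PiLp.norm_apply_le (latticePoint k) i
    _ = (1 + ‖latticePoint k‖) ^ (2 * d) := by simp [pow_mul]

end Lattice

section WaveletCoefficients

variable {d : ℕ}

theorem prod_comp_eq_prod_pow_card {ι κ M : Type*} [Fintype ι] [Fintype κ] [DecidableEq κ]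
    [CommMonoid M] (x : κ → M) (r : ι → κ) :
    ∏ i, x (r i) = ∏ k, x k ^ (Finset.univ.filter fun i => r i = k).card := by
  rw [← Finset.prod_fiberwise' Finset.univ r x]
  simp only [Finset.prod_const]

theorem hasVanishingMoments_of_monomials {f : 𝓢(Space d, ℝ)} {N : ℕ}
    (hf : ∀ n : Fin d → ℕ, ∑ i, n i < N → ∫ x : Space d, (∏ i, x i ^ n i) * f x = 0) :
    HasVanishingMoments volume f N := by
  intro n hn m
  let e (i : Fin d) : Space d := EuclideanSpace.single i 1
  have hexpand (y : Space d) : (m fun _ => y) * f y =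
      ∑ r : Fin n → Fin d, m (fun i => e (r i)) * ((∏ i, y (r i)) * f y) := by
    have hy : y = ∑ i, y i • e i := by
      ext j
      simp [e, Finset.sum_apply, Pi.single_apply]
    conv_lhs => rw [hy, m.map_sum, ← hy, Finset.sum_mul]
    refine Finset.sum_congr rfl fun r _ => ?_
    rw [m.map_smul_univ (fun i => y (r i)) fun i => e (r i), smul_eq_mul]
    ring
  have hmonomial (r : Fin n → Fin d) : ∫ y : Space d, (∏ i, y (r i)) * f y = 0 := by
    simp only [prod_comp_eq_prod_pow_card _ r]
    refine hf _ ?_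
    rwa [← Finset.card_eq_sum_card_fiberwise fun _ _ => Finset.mem_coe.2 (Finset.mem_univ _),
      Finset.card_univ, Fintype.card_fin]
  have hintegrable (r : Fin n → Fin d) : Integrable fun y : Space d => (∏ i, y (r i)) * f y := by
    simpa using integrable_multilinear_mul (μ := volume) f
      ((ContinuousMultilinearMap.mkPiAlgebra ℝ (Fin n) ℝ).compContinuousLinearMap
        fun i => EuclideanSpace.proj (r i))
  simp only [hexpand]
  rw [integral_finsetSum _ fun r _ => (hintegrable r).const_mul _]
  simp only [integral_const_mul, hmonomial, mul_zero, Finset.sum_const_zero]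

theorem integral_dilateTranslate_mul (f φ : 𝓢(Space d, ℝ)) (j : ℕ) (k : Fin d → ℤ) :
    ∫ x, dilateTranslate f j k x * φ x =
      (2 : ℝ) ^ ((j : ℝ) * (d : ℝ) / 2) * ((2 : ℝ) ^ (j * d))⁻¹ *
        ∫ y, φ (((2 : ℝ) ^ j)⁻¹ • latticePoint k + ((2 : ℝ) ^ j)⁻¹ • y) * f y := by
  let G (y : Space d) : ℝ := φ (((2 : ℝ) ^ j)⁻¹ • latticePoint k + ((2 : ℝ) ^ j)⁻¹ • y) * f y
  have hG (x : Space d) : dilateTranslate f j k x * φ x =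
      (2 : ℝ) ^ ((j : ℝ) * (d : ℝ) / 2) * G ((2 : ℝ) ^ j • x - latticePoint k) := by
    simp only [G, ← smul_add, add_sub_cancel, dilateTranslate_apply, mul_assoc]
    rw [inv_smul_smul₀ (by positivity), mul_comm (φ x)]
  have hscale := Measure.integral_comp_smul volume (fun z => G (z - latticePoint k)) ((2 : ℝ) ^ j)
  rw [integral_sub_right_eq_self (μ := volume) G, abs_of_pos (by positivity),
    finrank_euclideanSpace_fin, ← pow_mul, smul_eq_mul] at hscale
  simp only [hG]
  rw [integral_const_mul, hscale, mul_assoc]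

theorem exists_integral_dilateTranslate_mul_le {f : 𝓢(Space d, ℝ)} {N : ℕ}
    (hf : HasVanishingMoments volume f N) :
    ∃ C, 0 ≤ C ∧ ∀ (φ : 𝓢(Space d, ℝ)) (j : ℕ) (k : Fin d → ℤ),
      (2 : ℝ) ^ (j * N) * |∫ x, dilateTranslate f j k x * φ x| ≤
        C * (2 : ℝ) ^ (j * (2 * d)) * ((1 + ‖latticePoint k‖) ^ (2 * d))⁻¹ *
          maxSeminorm (2 * d, N) φ := by
  obtain ⟨C, hC, hbound⟩ := hf.exists_integral_comp_le (2 * d)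
  refine ⟨C, hC, fun φ j k => ?_⟩
  set c : ℝ := ((2 : ℝ) ^ j)⁻¹ with hc
  have hc0 : 0 < c := by positivity
  have hc1 : c ≤ 1 := inv_le_one_of_one_le₀ (one_le_pow₀ one_le_two)
  set I := ∫ y, φ (c • latticePoint k + c • y) * f y with hI
  have hpow (n : ℕ) : (2 : ℝ) ^ (j * n) = (c ^ n)⁻¹ := by rw [hc, inv_pow, inv_inv, pow_mul]
  have hfactor : (2 : ℝ) ^ ((j : ℝ) * (d : ℝ) / 2) * ((2 : ℝ) ^ (j * d))⁻¹ ≤ 1 := by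
    rw [← div_eq_mul_inv, div_le_one (by positivity), ← Real.rpow_natCast]
    refine Real.rpow_le_rpow_of_exponent_le one_le_two ?_
    push_cast
    exact half_le_self (by positivity)
  have hnorm : c * (1 + ‖latticePoint k‖) ≤ 1 + ‖c • latticePoint k‖ := by
    rw [norm_smul, Real.norm_of_nonneg hc0.le]
    linarith
  have hshrunk : c ^ (2 * d) * (1 + ‖latticePoint k‖) ^ (2 * d) * |I| ≤
      C * c ^ N * maxSeminorm (2 * d, N) φ := by
    refine le_trans ?_ (hbound φ (c • latticePoint k) c hc0.le hc1)
    rw [← mul_pow]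
    gcongr
  calc (2 : ℝ) ^ (j * N) * |∫ x, dilateTranslate f j k x * φ x|
      ≤ (2 : ℝ) ^ (j * N) * |I| := by
        rw [integral_dilateTranslate_mul, ← hc, ← hI, abs_mul, abs_of_nonneg (by positivity)]
        exact mul_le_mul_of_nonneg_left (mul_le_of_le_one_left (abs_nonneg I) hfactor)
          (by positivity)
    _ = (c ^ N)⁻¹ * (c ^ (2 * d))⁻¹ * ((1 + ‖latticePoint k‖) ^ (2 * d))⁻¹ *
          (c ^ (2 * d) * (1 + ‖latticePoint k‖) ^ (2 * d) * |I|) := by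
        rw [hpow]; field_simp
    _ ≤ (c ^ N)⁻¹ * (c ^ (2 * d))⁻¹ * ((1 + ‖latticePoint k‖) ^ (2 * d))⁻¹ *
          (C * c ^ N * maxSeminorm (2 * d, N) φ) := by gcongr
    _ = _ := by rw [hpow]; field_simp

/-- The index set as the disjoint union of the scaling indices and the wavelet indices. -/
def Index.equivSum (d : ℕ) :
    Index d ≃ (Fin d → ℤ) ⊕ (Fin (2 ^ d - 1) × ℕ × (Fin d → ℤ)) where
  toFun
    | .scaling k => Sum.inl k
    | .wavelet e j k => Sum.inr (e, j, k)
  invFun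
    | Sum.inl k => .scaling k
    | Sum.inr (e, j, k) => .wavelet e j k
  left_inv i := by cases i <;> rfl
  right_inv i := by rcases i with k | ⟨e, j, k⟩ <;> rfl

theorem Index.summable {b : Index d → ℝ} (hscaling : Summable fun k => b (.scaling k))
    (hwavelet : ∀ e, Summable fun x : ℕ × (Fin d → ℤ) => b (.wavelet e x.1 x.2)) :
    Summable b := by
  rw [← (Index.equivSum d).symm.summable_iff]
  refine Summable.sum _ hscaling (.of_abs ?_)
  rw [summable_prod_of_nonneg fun _ => abs_nonneg _]
  exact ⟨fun e => (hwavelet e).abs, .of_finite⟩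

theorem WaveletBasis.hasVanishingMoments_mother (W : WaveletBasis d) (e : Fin (2 ^ d - 1))
    (N : ℕ) : HasVanishingMoments volume (W.mother e) N :=
  hasVanishingMoments_of_monomials fun n _ => W.moment_eq_zero e n

theorem WaveletBasis.exists_integral_scaling_mul_le (W : WaveletBasis d) (N : ℕ) :
    ∃ C, ∀ (φ : 𝓢(Space d, ℝ)) (k : Fin d → ℤ), |∫ x, W.psi (.scaling k) x * φ x| ≤
      C * ((1 + ‖latticePoint k‖) ^ (2 * d))⁻¹ * maxSeminorm (2 * d, N) φ := by
  obtain ⟨C, hC, hbound⟩ := exists_integral_dilateTranslate_mul_le (f := W.father) (N := 0)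
    fun n hn => absurd hn (Nat.not_lt_zero n)
  refine ⟨C, fun φ k => ?_⟩
  have hφ : maxSeminorm (2 * d, 0) φ ≤ maxSeminorm (2 * d, N) φ :=
    Finset.sup_mono (f := schwartzSeminormFamily ℝ (Space d) ℝ)
      (Finset.Iic_subset_Iic.2 (Prod.mk_le_mk.2 ⟨le_rfl, N.zero_le⟩)) φ
  have h := hbound φ 0 k
  simp only [zero_mul, pow_zero, mul_one, one_mul] at h
  exact h.trans (mul_le_mul_of_nonneg_left hφ (by positivity))

theorem WaveletBasis.exists_integral_wavelet_mul_le (W : WaveletBasis d) (e : Fin (2 ^ d - 1))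
    (A : ℕ) :
    ∃ C, ∀ (φ : 𝓢(Space d, ℝ)) (j : ℕ) (k : Fin d → ℤ),
      (2 : ℝ) ^ (A * j) * |∫ x, W.psi (.wavelet e j k) x * φ x| ≤
        C * ((1 / 2) ^ j * ((1 + ‖latticePoint k‖) ^ (2 * d))⁻¹) *
          maxSeminorm (2 * d, A + 1 + 2 * d) φ := by
  obtain ⟨C, -, hbound⟩ := exists_integral_dilateTranslate_mul_le
    (W.hasVanishingMoments_mother e (A + 1 + 2 * d))
  refine ⟨C, fun φ j k => le_of_mul_le_mul_left ?_
    (by positivity : (0 : ℝ) < 2 ^ j * 2 ^ (j * (2 * d)))⟩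
  calc _ = (2 : ℝ) ^ (j * (A + 1 + 2 * d)) * |∫ x, W.psi (.wavelet e j k) x * φ x| := by
        rw [show j * (A + 1 + 2 * d) = j + j * (2 * d) + A * j by ring, pow_add, pow_add]
        ring
    _ ≤ _ := hbound φ j k
    _ = _ := by rw [one_div, inv_pow]; field_simp

theorem WaveletBasis.exists_summable_bound (W : WaveletBasis d) (A : ℕ) :
    ∃ b : Index d → ℝ, Summable b ∧ ∃ m : ℕ × ℕ, ∀ (φ : 𝓢(Space d, ℝ)) (i : Index d),
      (2 : ℝ) ^ (A * i.scale) * |∫ x, W.psi i x * φ x| ≤ b i * maxSeminorm m φ := by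
  obtain ⟨C₀, hC₀⟩ := W.exists_integral_scaling_mul_le (A + 1 + 2 * d)
  choose C hC using fun e => W.exists_integral_wavelet_mul_le e A
  let b : Index d → ℝ
    | .scaling k => C₀ * ((1 + ‖latticePoint k‖) ^ (2 * d))⁻¹
    | .wavelet e j k => C e * ((1 / 2) ^ j * ((1 + ‖latticePoint k‖) ^ (2 * d))⁻¹)
  have hlattice := summable_one_add_norm_latticePoint_inv d
  refine ⟨b, Index.summable (hlattice.mul_left C₀) fun e => ?_,
    (2 * d, A + 1 + 2 * d), fun φ i => ?_⟩
  · exact (summable_geometric_two.mul_of_nonneg hlattice (fun _ => by positivity)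
      fun _ => by positivity).mul_left (C e)
  · cases i with
    | scaling k => simpa [Index.scale] using hC₀ φ k
    | wavelet e j k => exact hC e φ j k

end WaveletCoefficients

section Distributions

variable {d : ℕ}

/-- The tempered distribution `χ ↦ ∫ f χ` induced by a Schwartz function `f`. -/
noncomputable def regularDistr (f : 𝓢(Space d, ℝ)) : Distr d :=
  SchwartzMap.integralCLM ℝ volume ∘L SchwartzMap.pairing (ContinuousLinearMap.mul ℝ ℝ) f

theorem regularDistr_apply (f χ : 𝓢(Space d, ℝ)) : regularDistr f χ = ∫ x, f x * χ x := by
  simp [regularDistr, SchwartzMap.integralCLM_apply]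

theorem exists_hasSum_of_maxSeminorm_bound {E F ι : Type*} [NormedAddCommGroup E]
    [NormedSpace ℝ E] [NormedAddCommGroup F] [NormedSpace ℝ F] [CompleteSpace F]
    {T : ι → 𝓢(E, ℝ) →L[ℝ] F} {b : ι → ℝ} (hb : Summable b) {m : ℕ × ℕ}
    (hT : ∀ i φ, ‖T i φ‖ ≤ b i * maxSeminorm m φ) :
    ∃ g : 𝓢(E, ℝ) →L[ℝ] F, ∀ φ, HasSum (fun i => T i φ) (g φ) := by
  have hsum (φ : 𝓢(E, ℝ)) : Summable fun i => T i φ :=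
    .of_norm_bounded (hb.mul_right _) fun i => hT i φ
  refine ⟨SchwartzMap.mkCLMtoNormedSpace (σ := RingHom.id ℝ) (fun φ => ∑' i, T i φ) ?_ ?_ ?_,
    fun φ => (hsum φ).hasSum⟩
  · intro φ χ
    simp only [map_add, (hsum φ).tsum_add (hsum χ)]
  · intro a φ
    simp only [map_smul, RingHom.id_apply, tsum_const_smul'']
  · refine ⟨Finset.Iic m, |∑' i, b i|, abs_nonneg _, fun φ => ?_⟩
    exact (tsum_of_norm_bounded (hb.hasSum.mul_right _) fun i => hT i φ).trans
      (mul_le_mul_of_nonneg_right (le_abs_self _) (apply_nonneg _ _))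

theorem WaveletBasis.exists_hasSum_waveletSeries (W : WaveletBasis d) {ξ : Index d → ℝ} {B : ℝ}
    {A : ℕ} (hξ : ∀ i, |ξ i| ≤ B * (2 : ℝ) ^ (A * i.scale)) :
    ∃ g : Distr d, ∀ φ : 𝓢(Space d, ℝ), HasSum (fun i => ξ i * ∫ x, W.psi i x * φ x) (g φ) := by
  obtain ⟨b, hb, m, hbound⟩ := W.exists_summable_bound A
  have hB : 0 ≤ B := by simpa [Index.scale] using (abs_nonneg _).trans (hξ (.scaling 0))
  simp only [← regularDistr_apply] at hbound ⊢
  refine exists_hasSum_of_maxSeminorm_bound (T := fun i => ξ i • regularDistr (W.psi i))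
    (hb.mul_left B) (m := m) fun i φ => ?_
  calc ‖ξ i * regularDistr (W.psi i) φ‖
      ≤ B * (2 : ℝ) ^ (A * i.scale) * |regularDistr (W.psi i) φ| := by
        rw [norm_mul]
        exact mul_le_mul_of_nonneg_right (hξ i) (abs_nonneg _)
    _ = B * ((2 : ℝ) ^ (A * i.scale) * |regularDistr (W.psi i) φ|) := mul_assoc _ _ _
    _ ≤ B * (b i * maxSeminorm m φ) := mul_le_mul_of_nonneg_left (hbound φ i) hB
    _ = _ := (mul_assoc _ _ _).symm

theorem WaveletBasis.integral_psi_mul_psi [DecidableEq (Index d)] (W : WaveletBasis d)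
    (i j : Index d) : ∫ x, W.psi i x * W.psi j x = if i = j then 1 else 0 := by
  rw [← orthonormal_iff_ite.1 W.orthonormal i j, L2.inner_def]
  refine integral_congr_ae ?_
  filter_upwards [(W.psi i).coeFn_toLp 2 volume, (W.psi j).coeFn_toLp 2 volume] with x hi hj
  change _ = inner ℝ ((W.psi i).toLp 2 volume x) ((W.psi j).toLp 2 volume x)
  rw [hi, hj, real_inner_comm]
  rfl

theorem WaveletBasis.apply_psi_of_hasSum (W : WaveletBasis d) {ξ : Index d → ℝ} {g : Distr d}
    (hg : ∀ φ : 𝓢(Space d, ℝ), HasSum (fun i => ξ i * ∫ x, W.psi i x * φ x) (g φ))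
    (i : Index d) : g (W.psi i) = ξ i := by
  classical
  refine (hg (W.psi i)).unique ?_
  simpa [W.integral_psi_mul_psi] using
    hasSum_single (f := fun j => ξ j * ∫ x, W.psi j x * W.psi i x) i fun j hj => by
      rw [W.integral_psi_mul_psi, if_neg hj, mul_zero]

end Distributions

section BesovSpaces

variable {d : ℕ} {W : WaveletBasis d} {s p : ℝ}

theorem memℓp_ofReal_iff {ι : Type*} {x : ι → ℝ} (hp : 0 < p) :
    Memℓp x (ENNReal.ofReal p) ↔ Summable fun i => |x i| ^ p := by
  rw [memℓp_gen_iff (by rwa [ENNReal.toReal_ofReal hp.le]), ENNReal.toReal_ofReal hp.le]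
  rfl

theorem abs_le_of_hasSum_abs_rpow {ι : Type*} {x : ι → ℝ} {S : ℝ} (hp : 0 < p)
    (hx : HasSum (fun i => |x i| ^ p) S) (i : ι) : |x i| ≤ S ^ (1 / p) := by
  rw [one_div, Real.le_rpow_inv_iff_of_pos (abs_nonneg _) (hx.nonneg fun _ => by positivity) hp]
  exact le_hasSum hx i fun _ _ => by positivity

theorem weight_pos (s p : ℝ) (i : Index d) : 0 < weight s p i := by
  unfold weight; positivity

theorem weight_rpow (s : ℝ) (hp : p ≠ 0) (i : Index d) :
    weight s p i ^ p = (2 : ℝ) ^ ((p * s + d * (p / 2 - 1)) * i.scale) := by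
  rw [weight, ← Real.rpow_mul two_pos.le]
  congr 1
  field_simp

theorem exists_one_le_weight_mul_two_pow (d : ℕ) (s p : ℝ) :
    ∃ A : ℕ, ∀ i : Index d, 1 ≤ weight s p i * (2 : ℝ) ^ (A * i.scale) := by
  obtain ⟨A, hA⟩ := exists_nat_ge (-(s + (d : ℝ) * (1 / 2 - 1 / p)))
  refine ⟨A, fun i => ?_⟩
  rw [weight, ← Real.rpow_natCast, ← Real.rpow_add two_pos, Nat.cast_mul, ← add_mul]
  exact Real.one_le_rpow one_le_two (mul_nonneg (by linarith) i.scale.cast_nonneg)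

/-- The weighted wavelet coefficients `2^((s + d (1/2 - 1/p)) |λ|) u_λ` of a distribution `u`. They
identify `B^s_{p,p}` with the unweighted sequence space `ℓ^p(Λ)`. -/
noncomputable def besovCoeff (W : WaveletBasis d) (s p : ℝ) : Distr d →ₗ[ℝ] Index d → ℝ where
  toFun u i := weight s p i * u (W.psi i)
  map_add' u v := by ext i; exact mul_add _ _ _
  map_smul' c u := by ext i; exact mul_left_comm _ _ _

theorem besovCoeff_apply (W : WaveletBasis d) (s p : ℝ) (u : Distr d) (i : Index d) :
    besovCoeff W s p u i = weight s p i * u (W.psi i) :=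
  rfl

theorem mem_besov_iff (hp : 0 < p) {u : Distr d} :
    u ∈ Besov W s p ↔ Summable (fun i => |besovCoeff W s p u i| ^ p) ∧
      ∀ φ : 𝓢(Space d, ℝ), HasSum (fun i => u (W.psi i) * ∫ x, W.psi i x * φ x) (u φ) :=
  and_congr_left' (memℓp_ofReal_iff hp)

theorem besovNorm_eq (W : WaveletBasis d) (s p : ℝ) (u : Distr d) :
    besovNorm W s p u = (∑' i, |besovCoeff W s p u i| ^ p) ^ (1 / p) := by
  unfold besovNorm
  congr 1
  refine tsum_congr fun i => ?_
  rw [besovCoeff_apply, abs_mul, abs_of_pos (weight_pos s p i),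
    Real.mul_rpow (weight_pos s p i).le (abs_nonneg _), weight, ← Real.rpow_mul two_pos.le]
  ring_nf

theorem besovNorm_nonneg (W : WaveletBasis d) (s p : ℝ) (u : Distr d) :
    0 ≤ besovNorm W s p u := by
  rw [besovNorm_eq]
  exact Real.rpow_nonneg (tsum_nonneg fun i => by positivity) _

theorem besovNorm_rpow (hp : 0 < p) (u : Distr d) :
    besovNorm W s p u ^ p = ∑' i, |besovCoeff W s p u i| ^ p := by
  rw [besovNorm_eq, ← Real.rpow_mul (tsum_nonneg fun i => by positivity),
    one_div_mul_cancel hp.ne', Real.rpow_one]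

theorem hasSum_abs_besovCoeff_rpow (hp : 0 < p) {u : Distr d} (hu : u ∈ Besov W s p) :
    HasSum (fun i => |besovCoeff W s p u i| ^ p) (besovNorm W s p u ^ p) := by
  rw [besovNorm_rpow hp]
  exact ((mem_besov_iff hp).1 hu).1.hasSum

theorem abs_besovCoeff_le_besovNorm (hp : 0 < p) {u : Distr d} (hu : u ∈ Besov W s p)
    (i : Index d) : |besovCoeff W s p u i| ≤ besovNorm W s p u := by
  rw [besovNorm_eq]
  exact abs_le_of_hasSum_abs_rpow hp ((mem_besov_iff hp).1 hu).1.hasSum i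

theorem exists_mem_besov (W : WaveletBasis d) (hp : 0 < p) {ξ : Index d → ℝ}
    (hξ : Summable fun i => |weight s p i * ξ i| ^ p) :
    ∃ g ∈ Besov W s p, ∀ i, g (W.psi i) = ξ i := by
  obtain ⟨A, hA⟩ := exists_one_le_weight_mul_two_pow d s p
  have hbound (i : Index d) : |ξ i| ≤
      (∑' i, |weight s p i * ξ i| ^ p) ^ (1 / p) * (2 : ℝ) ^ (A * i.scale) := by
    calc |ξ i| ≤ |ξ i| * (weight s p i * (2 : ℝ) ^ (A * i.scale)) :=
          le_mul_of_one_le_right (abs_nonneg _) (hA i)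
      _ = |weight s p i * ξ i| * (2 : ℝ) ^ (A * i.scale) := by
          rw [abs_mul, abs_of_pos (weight_pos s p i)]; ring
      _ ≤ _ := mul_le_mul_of_nonneg_right (abs_le_of_hasSum_abs_rpow hp hξ.hasSum i)
          (by positivity)
  obtain ⟨g, hg⟩ := W.exists_hasSum_waveletSeries hbound
  have hcoeff := W.apply_psi_of_hasSum hg
  refine ⟨g, (mem_besov_iff hp).2 ⟨?_, fun φ => ?_⟩, hcoeff⟩
  · simpa only [besovCoeff_apply, hcoeff] using hξ
  · simpa only [hcoeff] using hg φ

theorem regularDistr_psi_apply_psi [DecidableEq (Index d)] (W : WaveletBasis d) (i j : Index d) :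
    regularDistr (W.psi i) (W.psi j) = if i = j then 1 else 0 := by
  rw [regularDistr_apply, W.integral_psi_mul_psi]

theorem regularDistr_psi_mem_besov (W : WaveletBasis d) (s : ℝ) (hp : 0 < p) (i : Index d) :
    regularDistr (W.psi i) ∈ Besov W s p := by
  classical
  refine (mem_besov_iff hp).2 ⟨summable_of_ne_finset_zero (s := {i}) fun j hj => ?_, fun φ => ?_⟩
  · rw [besovCoeff_apply, regularDistr_psi_apply_psi, if_neg (by simpa [eq_comm] using hj),
      mul_zero, abs_zero, Real.zero_rpow hp.ne']
  · simpa [regularDistr_psi_apply_psi, ← regularDistr_apply] using hasSum_single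
      (f := fun j => regularDistr (W.psi i) (W.psi j) * ∫ x, W.psi j x * φ x) i fun j hj => by
        rw [regularDistr_psi_apply_psi, if_neg hj.symm, zero_mul]

/-- The wavelet `ψ_λ` as an element of `B^s_{p,p}`. -/
noncomputable def psiBesov (W : WaveletBasis d) (s : ℝ) (hp : 0 < p) (i : Index d) :
    Besov W s p :=
  ⟨regularDistr (W.psi i), regularDistr_psi_mem_besov W s hp i⟩

theorem besovCoeff_sub_sum_psiBesov [DecidableEq (Index d)] (hp : 0 < p) (h : Besov W s p)
    (S : Finset (Index d)) (j : Index d) :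
    besovCoeff W s p
        (h - ∑ i ∈ S, (h : Distr d) (W.psi i) • psiBesov W s hp i : Besov W s p) j =
      if j ∈ S then 0 else besovCoeff W s p h j := by
  have hsum : ((∑ i ∈ S, (h : Distr d) (W.psi i) • psiBesov W s hp i : Besov W s p) : Distr d)
      (W.psi j) = if j ∈ S then (h : Distr d) (W.psi j) else 0 := by
    simp [psiBesov, regularDistr_psi_apply_psi, _root_.sum_apply]
  rw [besovCoeff_apply, Submodule.coe_sub, _root_.sub_apply, hsum]
  split_ifs <;> simp [besovCoeff_apply]

theorem tendsto_besovNorm_sub_sum_psiBesov (hp : 0 < p) (h : Besov W s p) :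
    Tendsto (fun S : Finset (Index d) => besovNorm W s p
      (h - ∑ i ∈ S, (h : Distr d) (W.psi i) • psiBesov W s hp i : Besov W s p)) atTop (𝓝 0) := by
  classical
  have htail := (tendsto_tsum_compl_atTop_zero fun i => |besovCoeff W s p h i| ^ p).rpow_const
    (p := 1 / p) (Or.inr (by positivity))
  rw [Real.zero_rpow (by positivity)] at htail
  refine htail.congr fun S => ?_
  have hcompl : ∑' i : {i | i ∉ S}, |besovCoeff W s p h i| ^ p =
      ∑' i, {i | i ∉ S}.indicator (fun i => |besovCoeff W s p h i| ^ p) i :=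
    tsum_subtype _ fun i => |besovCoeff W s p h i| ^ p
  refine (congrArg (· ^ (1 / p)) hcompl).trans ?_
  rw [besovNorm_eq]
  congr 2 with i
  rw [besovCoeff_sub_sum_psiBesov]
  by_cases hi : i ∈ S <;> simp [hi, Real.zero_rpow hp.ne']

theorem IsBoundedOp.hasSum {F : Besov W s p →ₗ[ℝ] LTwo d} (hF : IsBoundedOp W F) (hp : 0 < p)
    (h : Besov W s p) :
    HasSum (fun i => (h : Distr d) (W.psi i) • F (psiBesov W s hp i)) (F h) := by
  obtain ⟨M, hM⟩ := hF
  have hlim := (tendsto_besovNorm_sub_sum_psiBesov hp h).const_mul M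
  rw [mul_zero] at hlim
  refine tendsto_iff_norm_sub_tendsto_zero.2
    (squeeze_zero (fun _ => norm_nonneg _) (fun S => ?_) hlim)
  set P := ∑ i ∈ S, (h : Distr d) (W.psi i) • psiBesov W s hp i with hP
  have hFP : F P = ∑ i ∈ S, (h : Distr d) (W.psi i) • F (psiBesov W s hp i) := by
    simp only [hP, map_sum, map_smul]
  have hsub : F (h - P) = F h - F P := map_sub F h P
  rw [← hFP, norm_sub_rev, ← hsub]
  exact hM (h - P)

theorem IsBoundedOp.exists_hasSum_inner {F : Besov W s p →ₗ[ℝ] LTwo d} (hF : IsBoundedOp W F)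
    (hp : 0 < p) {g : Distr d} (hg : g ∈ adjointRange W F) :
    ∃ w : LTwo d, ∀ h : Besov W s p,
      HasSum (fun i => g (W.psi i) * (h : Distr d) (W.psi i)) (inner ℝ w (F h)) := by
  obtain ⟨w, hw⟩ := hg
  refine ⟨w, fun h => ((hF.hasSum hp h).mapL (innerSL ℝ w)).congr_fun fun i => ?_⟩
  rw [hw (W.psi i) (psiBesov W s hp i) (regularDistr_apply (W.psi i)), innerSL_apply_apply,
    inner_smul_right, mul_comm]

end BesovSpaces

section BregmanDistance

/-- The derivative `p |x|^(p-2) x` of `x ↦ |x|^p`, for `1 < p`. -/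
noncomputable def absRpowDeriv (p x : ℝ) : ℝ :=
  p * |x| ^ (p - 2) * x

theorem hasDerivAt_absRpowDeriv {p : ℝ} (hp : 1 < p) (x : ℝ) :
    HasDerivAt (fun t : ℝ => |t| ^ p) (absRpowDeriv p x) x :=
  hasDerivAt_abs_rpow x hp

theorem abs_absRpowDeriv {p : ℝ} (hp : 1 < p) (x : ℝ) :
    |absRpowDeriv p x| = p * |x| ^ (p - 1) := by
  rw [absRpowDeriv, abs_mul, abs_mul, abs_of_pos (zero_lt_one.trans hp),
    abs_of_nonneg (by positivity), mul_assoc]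
  rcases eq_or_ne x 0 with rfl | hx
  · simp [Real.zero_rpow (sub_pos.2 hp).ne']
  · rw [← Real.rpow_add_one (abs_ne_zero.2 hx)]
    ring_nf

theorem absRpowDeriv_neg (p x : ℝ) : absRpowDeriv p (-x) = -absRpowDeriv p x := by
  simp [absRpowDeriv]

theorem absRpowDeriv_of_nonneg {p x : ℝ} (hp : 1 < p) (hx : 0 ≤ x) :
    absRpowDeriv p x = p * x ^ (p - 1) := by
  have hderiv : 0 ≤ absRpowDeriv p x :=
    mul_nonneg (mul_nonneg (zero_lt_one.trans hp).le (by positivity)) hx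
  rw [← abs_of_nonneg hderiv, abs_absRpowDeriv hp, abs_of_nonneg hx]

theorem absRpowDeriv_mul_self {p : ℝ} (hp : 1 < p) (x : ℝ) :
    absRpowDeriv p x * x = p * |x| ^ p := by
  have hnonneg : 0 ≤ absRpowDeriv p x * x := by
    rw [absRpowDeriv, mul_assoc]
    exact mul_nonneg (mul_nonneg (zero_lt_one.trans hp).le (by positivity)) (mul_self_nonneg x)
  rw [← abs_of_nonneg hnonneg, abs_mul, abs_absRpowDeriv hp, mul_assoc,
    ← Real.rpow_add_one' (abs_nonneg x) (by linarith), sub_add_cancel]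

theorem monotoneOn_Icc_neg_of_odd {f : ℝ → ℝ} {M : ℝ} (hM : 0 ≤ M) (hodd : ∀ x, f (-x) = -f x)
    (hf : MonotoneOn f (Set.Icc 0 M)) : MonotoneOn f (Set.Icc (-M) M) := by
  have hneg : MonotoneOn f (Set.Icc (-M) 0) := by
    intro x hx y hy hxy
    have := hf ⟨neg_nonneg.2 hy.2, neg_le.1 hy.1⟩ ⟨neg_nonneg.2 hx.2, neg_le.1 hx.1⟩
      (neg_le_neg hxy)
    rwa [hodd, hodd, neg_le_neg_iff] at this
  rw [← Set.Icc_union_Icc_eq_Icc (neg_nonpos.2 hM) hM]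
  exact hneg.union_right hf (isGreatest_Icc (neg_nonpos.2 hM)) (isLeast_Icc hM)

theorem monotoneOn_rpow_sub_mul {p M : ℝ} (hp : 1 < p) (hp2 : p ≤ 2) :
    MonotoneOn (fun x : ℝ => p * x ^ (p - 1) - p * (p - 1) * M ^ (p - 2) * x) (Set.Icc 0 M) := by
  refine monotoneOn_of_hasDerivWithinAt_nonneg (convex_Icc 0 M)
    (f' := fun x => p * ((p - 1) * x ^ (p - 1 - 1)) - p * (p - 1) * M ^ (p - 2) * 1) ?_ ?_ ?_
  · exact ((continuous_const.mul (Real.continuous_rpow_const (by linarith))).sub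
      (by fun_prop)).continuousOn
  · intro x hx
    rw [interior_Icc] at hx
    exact (((Real.hasDerivAt_rpow_const (Or.inl hx.1.ne')).const_mul p).sub
      ((hasDerivAt_id x).const_mul _)).hasDerivWithinAt
  · intro x hx
    rw [interior_Icc] at hx
    have hpow : M ^ (p - 2) ≤ x ^ (p - 2) :=
      Real.rpow_le_rpow_of_nonpos hx.1 hx.2.le (by linarith)
    rw [sub_nonneg, mul_one, show p - 1 - 1 = p - 2 by ring, ← mul_assoc]
    have : 0 ≤ p * (p - 1) := mul_nonneg (by linarith) (by linarith)
    gcongr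

theorem strongConvexOn_abs_rpow {p M : ℝ} (hp : 1 < p) (hp2 : p ≤ 2) (hM : 0 ≤ M) :
    StrongConvexOn (Set.Icc (-M) M) (p * (p - 1) * M ^ (p - 2)) fun x : ℝ => |x| ^ p := by
  set m := p * (p - 1) * M ^ (p - 2) with hm
  have hderiv (x : ℝ) : HasDerivAt (fun t : ℝ => |t| ^ p - m / 2 * ‖t‖ ^ 2)
      (absRpowDeriv p x - m * x) x := by
    simp only [Real.norm_eq_abs, sq_abs]
    refine ((hasDerivAt_absRpowDeriv hp x).sub ((hasDerivAt_pow 2 x).const_mul (m / 2))).congr_deriv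
      ?_
    simp
    ring
  have hmono : MonotoneOn (fun x => absRpowDeriv p x - m * x) (Set.Icc (-M) M) :=
    monotoneOn_Icc_neg_of_odd hM (fun x => by rw [absRpowDeriv_neg]; ring)
      ((monotoneOn_rpow_sub_mul hp hp2).congr fun x hx => by
        simp only [absRpowDeriv_of_nonneg hp hx.1, hm])
  refine strongConvexOn_iff_convex.2 (MonotoneOn.convexOn_of_deriv (convex_Icc _ _)
    (fun x _ => (hderiv x).continuousAt.continuousWithinAt)
    (fun x _ => (hderiv x).differentiableAt.differentiableWithinAt) ?_)
  exact (hmono.mono interior_subset).congr fun x _ => (hderiv x).deriv.symm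

theorem add_mul_sub_le_of_convexOn {s : Set ℝ} {f : ℝ → ℝ} {f' x a : ℝ} (hf : ConvexOn ℝ s f)
    (hx : x ∈ s) (ha : a ∈ s) (hderiv : HasDerivAt f f' a) : f a + f' * (x - a) ≤ f x := by
  rcases lt_trichotomy x a with hxa | rfl | hax
  · have := hf.slope_le_of_hasDerivAt hx ha hxa hderiv
    rw [slope_def_field, div_le_iff₀ (sub_pos.2 hxa)] at this
    linarith
  · simp
  · have := hf.le_slope_of_hasDerivAt ha hx hax hderiv
    rw [slope_def_field, le_div_iff₀ (sub_pos.2 hax)] at this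
    linarith

theorem add_mul_sub_add_sq_le_of_strongConvexOn {s : Set ℝ} {f : ℝ → ℝ} {m f' x a : ℝ}
    (hf : StrongConvexOn s m f) (hx : x ∈ s) (ha : a ∈ s) (hderiv : HasDerivAt f f' a) :
    f a + f' * (x - a) + m / 2 * (x - a) ^ 2 ≤ f x := by
  have htangent := add_mul_sub_le_of_convexOn (strongConvexOn_iff_convex.1 hf) hx ha
    (f' := f' - m * a) (by
      simp only [Real.norm_eq_abs, sq_abs]
      exact (hderiv.sub ((hasDerivAt_pow 2 a).const_mul (m / 2))).congr_deriv (by simp; ring))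
  simp only [Real.norm_eq_abs, sq_abs] at htangent
  linarith

theorem summable_sq_sub_and_tsum_le_of_hasSum_abs_rpow {ι : Type*} {p M L SX SA : ℝ} {X A : ι → ℝ}
    (hp : 1 < p) (hp2 : p ≤ 2) (hM : 0 < M) (hXM : ∀ i, |X i| ≤ M) (hAM : ∀ i, |A i| ≤ M)
    (hX : HasSum (fun i => |X i| ^ p) SX) (hA : HasSum (fun i => |A i| ^ p) SA)
    (hL : HasSum (fun i => absRpowDeriv p (A i) * (X i - A i)) L) :
    Summable (fun i => (X i - A i) ^ 2) ∧
      p * (p - 1) * M ^ (p - 2) / 2 * ∑' i, (X i - A i) ^ 2 ≤ SX - SA - L := by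
  set m := p * (p - 1) * M ^ (p - 2)
  have hm : 0 < m := mul_pos (mul_pos (by linarith) (by linarith)) (by positivity)
  have hbregman := (hX.sub hA).sub hL
  have hle (i : ι) : m / 2 * (X i - A i) ^ 2 ≤
      |X i| ^ p - |A i| ^ p - absRpowDeriv p (A i) * (X i - A i) := by
    have := add_mul_sub_add_sq_le_of_strongConvexOn (strongConvexOn_abs_rpow hp hp2 hM.le)
      (abs_le.1 (hXM i)) (abs_le.1 (hAM i)) (hasDerivAt_absRpowDeriv hp (A i))
    linarith
  have hsq : Summable fun i => m / 2 * (X i - A i) ^ 2 :=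
    .of_nonneg_of_le (fun _ => mul_nonneg (half_pos hm).le (sq_nonneg _)) hle hbregman.summable
  refine ⟨(summable_mul_left_iff (half_pos hm).ne').1 hsq, ?_⟩
  rw [← tsum_mul_left, ← hbregman.tsum_eq]
  exact hsq.tsum_le_tsum hle hbregman.summable

end BregmanDistance

section SourceCondition

variable {d : ℕ} {W : WaveletBasis d} {sD pD sS pS sG pG sR pR σ : ℝ}

/-- The wavelet coefficients of the gradient of `u ↦ ‖u‖_{B^s_{p,p}}^p` with respect to the pairing
`∑_λ g_λ h_λ`, for `1 < p`. -/
noncomputable def penaltyGradient (W : WaveletBasis d) (s p : ℝ) (u : Distr d) (i : Index d) : ℝ :=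
  weight s p i * absRpowDeriv p (besovCoeff W s p u i)

theorem penaltyGradient_mul_apply_psi (s p : ℝ) (u h : Distr d) (i : Index d) :
    penaltyGradient W s p u i * h (W.psi i) =
      absRpowDeriv p (besovCoeff W s p u i) * besovCoeff W s p h i := by
  rw [penaltyGradient, besovCoeff_apply W s p h]
  ring

theorem weight_rpow_mul_weight_rpow_le (hpS : 0 < pS) (hpG : 0 < pG) (hpR : pR = (pS + pG) / pG)
    (hsR : sR ≤ (pS * sS - pG * sG) / (pS + pG)) (i : Index d) :
    weight sG pG i ^ pG * weight sR pR i ^ (pS + pG) ≤ weight sS pS i ^ pS := by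
  have hsum : pS + pG = pR * pG := by rw [hpR, div_mul_cancel₀ _ hpG.ne']
  have hpR0 : pR ≠ 0 := by rw [hpR]; positivity
  rw [le_div_iff₀ (by positivity), hsum] at hsR
  rw [hsum, Real.rpow_mul (weight_pos sR pR i).le, weight_rpow sG hpG.ne', weight_rpow sR hpR0,
    weight_rpow sS hpS.ne', ← Real.rpow_mul two_pos.le, ← Real.rpow_add two_pos]
  refine Real.rpow_le_rpow_of_exponent_le one_le_two ?_
  have hexp : pG * sG + d * (pG / 2 - 1) + (pR * sR + d * (pR / 2 - 1)) * pG ≤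
      pS * sS + d * (pS / 2 - 1) := by
    calc pG * sG + d * (pG / 2 - 1) + (pR * sR + d * (pR / 2 - 1)) * pG
        = pG * sG + sR * (pR * pG) + d * ((pR * pG - pG) / 2 - 1) := by ring
      _ = pG * sG + sR * (pR * pG) + d * (pS / 2 - 1) := by rw [← hsum, add_sub_cancel_right]
      _ ≤ _ := by linarith
  calc _ = (pG * sG + d * (pG / 2 - 1) + (pR * sR + d * (pR / 2 - 1)) * pG) * i.scale := by ring
    _ ≤ _ := mul_le_mul_of_nonneg_right hexp i.scale.cast_nonneg

theorem summable_weight_mul_penaltyGradient (hpS : 0 < pS) (hpG : 0 < pG)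
    (hpR : pR = (pS + pG) / pG) (hsR : sR ≤ (pS * sS - pG * sG) / (pS + pG)) {u : Distr d}
    (hu : u ∈ Besov W sS pS) :
    Summable fun i => |weight sG pG i * penaltyGradient W sR pR u i| ^ pG := by
  have hpR1 : pR - 1 = pS / pG := by rw [hpR]; field_simp; ring
  have hpR_gt : 1 < pR := by linarith [div_pos hpS hpG]
  refine .of_nonneg_of_le (fun i => by positivity) (fun i => ?_)
    (((mem_besov_iff hpS).1 hu).1.mul_left (pR ^ pG))
  have hG := weight_pos sG pG i
  have hR := weight_pos sR pR i
  have hS := weight_pos sS pS i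
  calc |weight sG pG i * penaltyGradient W sR pR u i| ^ pG
      = (pR * (weight sG pG i * weight sR pR i *
          (weight sR pR i * |u (W.psi i)|) ^ (pS / pG))) ^ pG := by
        rw [penaltyGradient, abs_mul, abs_mul, abs_of_pos hG, abs_of_pos hR,
          abs_absRpowDeriv hpR_gt, besovCoeff_apply, abs_mul, abs_of_pos hR, hpR1]
        ring_nf
    _ = pR ^ pG * (weight sG pG i ^ pG * weight sR pR i ^ (pS + pG) * |u (W.psi i)| ^ pS) := by
        rw [Real.mul_rpow (by positivity) (by positivity),
          Real.mul_rpow (by positivity) (by positivity), ← Real.rpow_mul (by positivity),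
          div_mul_cancel₀ _ hpG.ne', Real.mul_rpow hG.le hR.le,
          Real.mul_rpow hR.le (abs_nonneg _), Real.rpow_add hR]
        ring
    _ ≤ pR ^ pG * (weight sS pS i ^ pS * |u (W.psi i)| ^ pS) := by
        gcongr
        exact weight_rpow_mul_weight_rpow_le hpS hpG hpR hsR i
    _ = pR ^ pG * |besovCoeff W sS pS u i| ^ pS := by
        rw [besovCoeff_apply, abs_mul, abs_of_pos hS, Real.mul_rpow hS.le (abs_nonneg _)]

/-- The source condition `F^* w = ∂(‖·‖_{B_R}^{p_R})(u)` with source element `w`, tested against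
`B_D`; the pairing of the gradient with `h ∈ B_D` is the sum over the wavelet coefficients. -/
def SourceCondition (W : WaveletBasis d) (F : Besov W sD pD →ₗ[ℝ] LTwo d) (sR pR : ℝ)
    (u : Distr d) (w : LTwo d) : Prop :=
  ∀ h : Besov W sD pD, HasSum (fun i => penaltyGradient W sR pR u i * (h : Distr d) (W.psi i))
    (inner ℝ w (F h))

variable {F : Besov W sD pD →ₗ[ℝ] LTwo d} {w : LTwo d}

theorem exists_sourceCondition (hpD : 0 < pD) (hpS : 0 < pS) (hpG : 0 < pG)
    (hpR : pR = (pS + pG) / pG) (hsR : sR ≤ (pS * sS - pG * sG) / (pS + pG))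
    (hF : IsBoundedOp W F) (hG : (Besov W sG pG : Set (Distr d)) ⊆ adjointRange W F)
    {u : Distr d} (hu : u ∈ Besov W sS pS) : ∃ w, SourceCondition W F sR pR u w := by
  obtain ⟨g, hgG, hg⟩ :=
    exists_mem_besov W hpG (summable_weight_mul_penaltyGradient hpS hpG hpR hsR hu)
  obtain ⟨w, hw⟩ := hF.exists_hasSum_inner hpD (hG hgG)
  exact ⟨w, fun h => by simpa only [hg] using hw h⟩

theorem SourceCondition.mem_besov {u : Besov W sD pD} (hw : SourceCondition W F sR pR u w)
    (hpR : 1 < pR) : (u : Distr d) ∈ Besov W sR pR := by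
  refine (mem_besov_iff (zero_lt_one.trans hpR)).2
    ⟨(summable_mul_left_iff (zero_lt_one.trans hpR).ne').1 ?_, u.2.2⟩
  simpa only [penaltyGradient_mul_apply_psi, absRpowDeriv_mul_self hpR] using (hw u).summable

theorem weight_two_eq_weight (hσ : σ = sR + (d : ℝ) * (1 / 2 - 1 / pR)) (i : Index d) :
    weight σ 2 i = weight sR pR i := by
  simp [weight, hσ]

theorem SourceCondition.sub_mem_besov_and_besovNorm_sq_le {M : ℝ} {udag u : Besov W sD pD}
    (hw : SourceCondition W F sR pR udag w) (hpR : 1 < pR) (hpR2 : pR ≤ 2)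
    (hσ : σ = sR + (d : ℝ) * (1 / 2 - 1 / pR)) (hu : (u : Distr d) ∈ Besov W sR pR) (hM : 0 < M)
    (huM : besovNorm W sR pR u ≤ M) (hudagM : besovNorm W sR pR udag ≤ M) :
    (u : Distr d) - udag ∈ Besov W σ 2 ∧
      pR * (pR - 1) * M ^ (pR - 2) / 2 * besovNorm W σ 2 ((u : Distr d) - udag) ^ 2 ≤
        besovNorm W sR pR u ^ pR - besovNorm W sR pR udag ^ pR - inner ℝ w (F u - F udag) := by
  have hp : 0 < pR := zero_lt_one.trans hpR
  have hudag := hw.mem_besov hpR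
  have hpair : HasSum (fun i => absRpowDeriv pR (besovCoeff W sR pR udag i) *
      (besovCoeff W sR pR u i - besovCoeff W sR pR udag i)) (inner ℝ w (F u - F udag)) := by
    rw [inner_sub_right]
    simpa only [penaltyGradient_mul_apply_psi, ← mul_sub] using (hw u).sub (hw udag)
  obtain ⟨hsq, hle⟩ := summable_sq_sub_and_tsum_le_of_hasSum_abs_rpow hpR hpR2 hM
    (fun i => (abs_besovCoeff_le_besovNorm hp hu i).trans huM)
    (fun i => (abs_besovCoeff_le_besovNorm hp hudag i).trans hudagM)
    (hasSum_abs_besovCoeff_rpow hp hu) (hasSum_abs_besovCoeff_rpow hp hudag) hpair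
  have hcoeff (i : Index d) : |besovCoeff W σ 2 ((u : Distr d) - udag) i| ^ (2 : ℝ) =
      (besovCoeff W sR pR u i - besovCoeff W sR pR udag i) ^ 2 := by
    rw [Real.rpow_two, sq_abs, besovCoeff_apply, weight_two_eq_weight hσ, ← besovCoeff_apply,
      map_sub, Pi.sub_apply]
  refine ⟨(mem_besov_iff two_pos).2 ⟨by simpa only [hcoeff] using hsq, (u - udag).2.2⟩, ?_⟩
  rw [← Real.rpow_two, besovNorm_rpow two_pos]
  simpa only [hcoeff] using hle

end SourceCondition

section ConvergenceRate

variable {d : ℕ} {W : WaveletBasis d} {sD pD sR pR σ α : ℝ} {F : Besov W sD pD →ₗ[ℝ] LTwo d}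
  {vδ : LTwo d} {u : Besov W sD pD}

theorem tikhonov_of_mem (hp : 0 ≤ pR) (hα : 0 ≤ α) (hu : (u : Distr d) ∈ Besov W sR pR) :
    tikhonov W F sR pR α vδ u =
      ENNReal.ofReal (‖F u - vδ‖ ^ 2 + α * besovNorm W sR pR u ^ pR) := by
  have hnorm := besovNorm_nonneg W sR pR u
  rw [tikhonov, besovENorm, if_pos hu, ENNReal.ofReal_rpow_of_nonneg hnorm hp,
    ← ENNReal.ofReal_mul hα, ← ENNReal.ofReal_add (by positivity) (by positivity)]

theorem tikhonov_of_notMem (hp : 0 < pR) (hα : 0 < α) (hu : (u : Distr d) ∉ Besov W sR pR) :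
    tikhonov W F sR pR α vδ u = ⊤ := by
  rw [tikhonov, besovENorm, if_neg hu, ENNReal.top_rpow_of_pos hp,
    ENNReal.mul_top (by simpa using hα), add_top]

theorem mem_besov_and_le_of_tikhonov_le {u' : Besov W sD pD} (hp : 0 < pR) (hα : 0 < α)
    (hu' : (u' : Distr d) ∈ Besov W sR pR)
    (hle : tikhonov W F sR pR α vδ u ≤ tikhonov W F sR pR α vδ u') :
    (u : Distr d) ∈ Besov W sR pR ∧ ‖F u - vδ‖ ^ 2 + α * besovNorm W sR pR u ^ pR ≤
      ‖F u' - vδ‖ ^ 2 + α * besovNorm W sR pR u' ^ pR := by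
  rw [tikhonov_of_mem hp.le hα.le hu'] at hle
  by_cases hu : (u : Distr d) ∈ Besov W sR pR
  · rw [tikhonov_of_mem hp.le hα.le hu] at hle
    have hnorm := besovNorm_nonneg W sR pR u'
    exact ⟨hu, (ENNReal.ofReal_le_ofReal_iff (by positivity)).1 hle⟩
  · rw [tikhonov_of_notMem hp hα hu, top_le_iff] at hle
    exact absurd hle ENNReal.ofReal_ne_top

variable {H : Type*} [SeminormedAddCommGroup H]

theorem sq_norm_sub_le_mul_div {v vδ : H} {c δ : ℝ} (hc : 0 < c) (hδ : 0 ≤ δ) (hα : c * δ ≤ α)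
    (hvδ : ‖v - vδ‖ ≤ δ) : ‖v - vδ‖ ^ 2 ≤ α * (δ / c) := by
  calc ‖v - vδ‖ ^ 2 ≤ δ ^ 2 := by gcongr
    _ = c * δ * (δ / c) := by field_simp
    _ ≤ α * (δ / c) := by gcongr

theorem le_add_of_tikhonov_le {v vδ y : H} {c δ S S₀ : ℝ} (hc : 0 < c) (hδ : 0 < δ)
    (hα : c * δ ≤ α) (hvδ : ‖v - vδ‖ ≤ δ)
    (hT : ‖y - vδ‖ ^ 2 + α * S ≤ ‖v - vδ‖ ^ 2 + α * S₀) : S ≤ S₀ + δ / c := by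
  have hα0 : 0 < α := (mul_pos hc hδ).trans_le hα
  refine le_of_mul_le_mul_left ?_ hα0
  linarith [sq_nonneg ‖y - vδ‖, sq_norm_sub_le_mul_div hc hδ.le hα hvδ]

theorem sub_sub_inner_le_of_tikhonov_le [InnerProductSpace ℝ H] {v vδ y : H} {c C δ S S₀ : ℝ}
    (hc : 0 < c) (hδ : 0 < δ) (hα : c * δ ≤ α) (hα' : α ≤ C * δ) (hvδ : ‖v - vδ‖ ≤ δ)
    (hT : ‖y - vδ‖ ^ 2 + α * S ≤ ‖v - vδ‖ ^ 2 + α * S₀) (w : H) :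
    S - S₀ - inner ℝ w (y - v) ≤ (1 / c + ‖w‖ + C * ‖w‖ ^ 2 / 4) * δ := by
  have hα0 : 0 < α := (mul_pos hc hδ).trans_le hα
  have hcomplete : 0 ≤ ‖y - vδ‖ ^ 2 + α * inner ℝ w (y - vδ) + α ^ 2 * ‖w‖ ^ 2 / 4 := by
    calc 0 ≤ ‖(y - vδ) + (α / 2) • w‖ ^ 2 := sq_nonneg _
      _ = _ := by
        rw [norm_add_sq_real, inner_smul_right, real_inner_comm, norm_smul, Real.norm_eq_abs,
          mul_pow, sq_abs]
        ring
  have hnoise : inner ℝ w (v - vδ) ≤ ‖w‖ * δ :=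
    (real_inner_le_norm _ _).trans (by gcongr)
  have hsplit : (inner ℝ w (y - v) : ℝ) = inner ℝ w (y - vδ) - inner ℝ w (v - vδ) := by
    rw [← inner_sub_right, sub_sub_sub_cancel_right]
  have hdata : ‖v - vδ‖ ^ 2 ≤ α * (δ / c) := sq_norm_sub_le_mul_div hc hδ.le hα hvδ
  refine le_of_mul_le_mul_left ?_ hα0
  calc α * (S - S₀ - inner ℝ w (y - v))
      ≤ α * (δ / c) + α * inner ℝ w (v - vδ) + α * (α * ‖w‖ ^ 2 / 4) := by
        rw [hsplit]; linarith
    _ ≤ α * (δ / c) + α * (‖w‖ * δ) + α * (C * δ * ‖w‖ ^ 2 / 4) := by gcongr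
    _ = _ := by ring

theorem SourceCondition.exists_besovNorm_sub_le_mul_sqrt {udag : Besov W sD pD} {w : LTwo d}
    (hw : SourceCondition W F sR pR udag w) (hpR : 1 < pR) (hpR2 : pR ≤ 2)
    (hσ : σ = sR + (d : ℝ) * (1 / 2 - 1 / pR)) {c C δ₀ : ℝ} (hc : 0 < c) (hC : 0 < C)
    (hδ₀ : 0 < δ₀) :
    ∃ K > 0, ∀ δ : ℝ, 0 < δ → δ ≤ δ₀ → ∀ α : ℝ, c * δ ≤ α → α ≤ C * δ →
      ∀ vδ : LTwo d, ‖F udag - vδ‖ ≤ δ → ∀ u : Besov W sD pD,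
        tikhonov W F sR pR α vδ u ≤ tikhonov W F sR pR α vδ udag →
        (u : Distr d) - udag ∈ Besov W σ 2 ∧
          besovNorm W σ 2 ((u : Distr d) - udag) ≤ K * √δ := by
  have hp : 0 < pR := zero_lt_one.trans hpR
  set S₀ := besovNorm W sR pR udag ^ pR
  have hS₀ : 0 ≤ S₀ := Real.rpow_nonneg (besovNorm_nonneg W sR pR udag) pR
  set M := (S₀ + δ₀ / c) ^ pR⁻¹
  have hnorm_le {u : Distr d} (hu : besovNorm W sR pR u ^ pR ≤ S₀ + δ₀ / c) :
      besovNorm W sR pR u ≤ M :=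
    (Real.le_rpow_inv_iff_of_pos (besovNorm_nonneg W sR pR u) (by positivity) hp).2 hu
  set m := pR * (pR - 1) * M ^ (pR - 2) / 2
  have hm : 0 < m :=
    half_pos (mul_pos (mul_pos hp (sub_pos.2 hpR)) (by positivity))
  set K₀ := 1 / c + ‖w‖ + C * ‖w‖ ^ 2 / 4
  refine ⟨√(K₀ / m), by positivity, fun δ hδ hδ₀' α hα hα' vδ hvδ u hle => ?_⟩
  obtain ⟨hu, hT⟩ := mem_besov_and_le_of_tikhonov_le hp ((mul_pos hc hδ).trans_le hα)
    (hw.mem_besov hpR) hle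
  have huM : besovNorm W sR pR u ≤ M :=
    hnorm_le ((le_add_of_tikhonov_le hc hδ hα hvδ hT).trans (by gcongr))
  obtain ⟨hmem, hbregman⟩ := hw.sub_mem_besov_and_besovNorm_sq_le hpR hpR2 hσ hu (by positivity)
    huM (hnorm_le (le_add_of_nonneg_right (by positivity)))
  refine ⟨hmem, ?_⟩
  rw [← Real.sqrt_mul (by positivity)]
  refine Real.le_sqrt_of_sq_le ?_
  rw [div_mul_eq_mul_div, le_div_iff₀ hm, mul_comm]
  exact hbregman.trans (sub_sub_inner_le_of_tikhonov_le hc hδ hα hα' hvδ hT w)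

end ConvergenceRate

end BesovTikhonov

open BesovTikhonov

theorem mainTheorem2_general {d : ℕ} (W : WaveletBasis d) (sD pD sS pS sG pG sR pR σ : ℝ)
    (hpD : 0 < pD) (hpS : 0 < pS) (hpG : 0 < pG) (hpSG : pS ≤ pG)
    (F : Besov W sD pD →ₗ[ℝ] LTwo d) (hF : IsBoundedOp W F)
    (hG : (Besov W sG pG : Set (Distr d)) ⊆ adjointRange W F)
    (udag : Besov W sD pD) (hudag : (udag : Distr d) ∈ Besov W sS pS)
    (v : LTwo d) (hv : F udag = v)
    (hpR : pR = (pS + pG) / pG) (hsR : sR ≤ (pS * sS - pG * sG) / (pS + pG))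
    (hσ : σ = sR + (d : ℝ) * (1 / 2 - 1 / pR))
    (c C δ₀ : ℝ) (hc : 0 < c) (hC : 0 < C) (hδ₀ : 0 < δ₀) :
    ∃ K > 0, ∀ δ : ℝ, 0 < δ → δ ≤ δ₀ → ∀ α : ℝ, c * δ ≤ α → α ≤ C * δ →
      ∀ vδ : LTwo d, ‖v - vδ‖ ≤ δ → ∀ u : Besov W sD pD,
        (∀ u' : Besov W sD pD, tikhonov W F sR pR α vδ u ≤ tikhonov W F sR pR α vδ u') →
        (u : Distr d) - udag ∈ Besov W σ 2 ∧
          besovNorm W σ 2 ((u : Distr d) - udag) ≤ K * √δ := by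
  have hpR_eq : pR = pS / pG + 1 := by rw [hpR, add_div, div_self hpG.ne']
  have hpR1 : 1 < pR := by linarith [div_pos hpS hpG]
  have hpR2 : pR ≤ 2 := by linarith [(div_le_one hpG).2 hpSG]
  obtain ⟨w, hw⟩ := exists_sourceCondition hpD hpS hpG hpR hsR hF hG hudag
  obtain ⟨K, hK, hrate⟩ := hw.exists_besovNorm_sub_le_mul_sqrt hpR1 hpR2 hσ hc hC hδ₀
  refine ⟨K, hK, fun δ hδ hδ₀ α hα hα' vδ hvδ u hmin => ?_⟩
  exact hrate δ hδ hδ₀ α hα hα' vδ (hv ▸ hvδ) u (hmin udag)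

theorem mainTheorem2 {d : ℕ} (W : BesovTikhonov.WaveletBasis d)
    (sD pD sS pS sG pG sR pR σ : ℝ)
    (hpD : 1 < pD) (hpS : 0 < pS) (hpG : 0 < pG) (hpSG : pS ≤ pG)
    (F : BesovTikhonov.Besov W sD pD →ₗ[ℝ] BesovTikhonov.LTwo d)
    (hF : BesovTikhonov.IsBoundedOp W F)
    (hG : (BesovTikhonov.Besov W sG pG : Set (BesovTikhonov.Distr d)) ⊆
      BesovTikhonov.adjointRange W F)
    (hSD : BesovTikhonov.Besov W sS pS ≤ BesovTikhonov.Besov W sD pD)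
    (udag : BesovTikhonov.Besov W sD pD)
    (hudag : (udag : BesovTikhonov.Distr d) ∈ BesovTikhonov.Besov W sS pS)
    (v : BesovTikhonov.LTwo d) (hv : F udag = v)
    (hpR : pR = (pS + pG) / pG)
    (hsR : sR ≤ (pS * sS - pG * sG) / (pS + pG))
    (hσ : σ = sR + (d : ℝ) * (1 / 2 - 1 / pR))
    (c C : ℝ) (hc : 0 < c) (hC : 0 < C) :
    ∃ K > 0, ∃ δ₀ > 0, ∀ δ : ℝ, 0 < δ → δ ≤ δ₀ →
      ∀ α : ℝ, c * δ ≤ α → α ≤ C * δ →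
      ∀ vδ : BesovTikhonov.LTwo d, ‖v - vδ‖ ≤ δ →
      ∀ u : BesovTikhonov.Besov W sD pD,
        (∀ u' : BesovTikhonov.Besov W sD pD,
          BesovTikhonov.tikhonov W F sR pR α vδ u ≤ BesovTikhonov.tikhonov W F sR pR α vδ u') →
        (u : BesovTikhonov.Distr d) - (udag : BesovTikhonov.Distr d) ∈ BesovTikhonov.Besov W σ 2 ∧
        BesovTikhonov.besovNorm W σ 2
          ((u : BesovTikhonov.Distr d) - (udag : BesovTikhonov.Distr d)) ≤ K * √δ := by
  obtain ⟨K, hK, hrate⟩ := mainTheorem2_general W sD pD sS pS sG pG sR pR σ (zero_lt_one.trans hpD)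
    hpS hpG hpSG F hF hG udag hudag v hv hpR hsR hσ c C 1 hc hC one_pos
  exact ⟨K, hK, 1, one_pos, hrate⟩
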